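/- Let $p\ge 5$ be a prime, let $\mathbb{Z}_p$ be the ring of $p$-adic integers, and for $a\in\mathbb{Z}_p$ let $\langle a\rangle_p$ denote the least non-negative integer $r$ with $a\equiv r\pmod p$. For $x \in \mathbb{Z}_p$ let $$\Gamma_p(x)=\lim_{m\to x}(-1)^m\prod_{\substack{0<k<m\\ (k,p)=1}}k$$ (the limit over non-negative integers $m$ tending $p$-adically to $x$) be Morita's $p$-adic Gamma function, and let $(x)_0=1$, $(x)_k=x(x+1)\cdots(x+k-1)$ for $k\ge1$. Then for every $a\in\mathbb{Z}_p$ with $\langle a\rangle_p$ even, $$\sum_{k=0}^{p-1}\frac{\left(\frac12\right)_k(-a)_k(a+1)_k}{(1)_k(1)_k}\cdot\frac{1}{k!}\equiv(-1)^{\frac{p+1}{2}}\,\Gamma_p\!\left(-\frac a2\right)^2\Gamma_p\!\left(\frac{a+1}2\right)^2\pmod{p^2},$$ where the left-hand side is the truncated hypergeometric series ${}_3F_2\!\left(\tfrac12,-a,a+1;\,1,1;\,1\right)_{p-1}$ and the congruence modulo $p^2$ is in $\mathbb{Z}_p$. -/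

import Mathlib

open Filter Topology

noncomputable section

/-- The truncated hypergeometric series
`∑_{k = 0}^{n} ((a₁)_k ⋯ (a_r)_k) / ((b₁)_k ⋯ (b_s)_k) * z ^ k / k!` over a field `K`, where
`(x)_k = x (x + 1) ⋯ (x + k - 1)` is the rising factorial; `as` and `bs` are the lists of upper and
lower parameters. -/
def truncatedHypergeometric {K : Type*} [Field K] (as bs : List K) (z : K) (n : ℕ) : K :=
  ∑ k ∈ Finset.range (n + 1),
    (as.map fun x => (ascPochhammer K k).eval x).prod /
      (bs.map fun x => (ascPochhammer K k).eval x).prod * (z ^ k / (k.factorial : K))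

/-- The value `(-1) ^ m * ∏_{0 < k < m, (k, p) = 1} k` of the `p`-adic Gamma function at a
natural number `m`. -/
def padicGammaNat (p : ℕ) [Fact p.Prime] (m : ℕ) : ℤ_[p] :=
  (-1) ^ m * ∏ k ∈ (Finset.Ioo 0 m).filter (fun k => Nat.Coprime k p), (k : ℤ_[p])

/-- Morita's `p`-adic Gamma function `Γ_p : ℤ_p → ℤ_p` (for odd `p`): the limit of
`(-1) ^ m * ∏_{0 < k < m, (k, p) = 1} k` as the natural number `m` tends `p`-adically to `x`. -/
def padicGamma (p : ℕ) [Fact p.Prime] (x : ℤ_[p]) : ℤ_[p] :=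
  limUnder (comap (Nat.cast : ℕ → ℤ_[p]) (𝓝 x)) (padicGammaNat p)

/-- The congruence `x ≡ y (mod p ^ n)`, i.e. `x - y ∈ p ^ n ℤ_p`, for `p`-adic numbers. -/
def PadicCongr (p : ℕ) [Fact p.Prime] (n : ℕ) (x y : ℚ_[p]) : Prop :=
  ∃ c : ℤ_[p], x - y = (p : ℚ_[p]) ^ n * (c : ℚ_[p])

/-- The half `x / 2` of a `p`-adic integer, again a `p`-adic integer when `p` is odd. -/
def padicHalf {p : ℕ} [Fact p.Prime] (x : ℤ_[p]) : ℤ_[p] :=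
  x * PadicInt.inv 2

/-- For odd `p`, `padicHalf x` really is `x / 2`. -/
theorem two_mul_padicHalf {p : ℕ} [Fact p.Prime] (hp : p ≠ 2) (x : ℤ_[p]) :
    2 * padicHalf x = x := by
  have h2 : ‖(2 : ℤ_[p])‖ = 1 := by
    have h : ‖((2 : ℕ) : ℤ_[p])‖ = 1 := by
      rw [PadicInt.norm_natCast_eq_one_iff]
      exact (Nat.coprime_primes Fact.out Nat.prime_two).2 hp
    exact_mod_cast h
  have h := PadicInt.mul_inv h2
  unfold padicHalf
  linear_combination x * h

end

/-!
Write `a = n + p t` with `0 ≤ n < p` even. For `k < p` the coefficients `(1/2)_k / k!³` are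
`p`-integral, so the truncated series is a polynomial `S(a)` over `ℤ_p`, and `S(n + p t)` is, modulo
`p²`, an affine function of `t`. The right-hand side `G(a)` (`gammaProduct`) is also affine in `t`
modulo `p²`. Two affine functions of `t` that agree at `t = 0` and `t = -1` agree everywhere
(`IsLinearModSq.sq_dvd_sub`), so it suffices to compare `S` and `G` at `n` and at `n - p`. Both
functions are invariant under `x ↦ -1 - x`, which takes `n - p` to the even number `p - 1 - n`.
Hence only the equality `S(n) = G(n)` for even `n < p` is needed
(`sum_hypergeometricTerm_eq_gammaProduct`).

That equality is exact. Zeilberger's algorithm gives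
`(n + 2)² S(n + 2) = (n + 1)² S(n)` (`sum_hypergeometricTerm_add_two`), the functional equation of
`Γ_p` gives the same recurrence for `G`, and `S(0) = 1 = G(0)` because
`Γ_p(1/2)² = (-1) ^ ((p + 1) / 2)`, a case of the reflection formula.

That `Γ_p` is affine modulo `p²` along `x + p ℤ_p` also follows from the reflection formula. In the
form `Γ_p(p) Γ_p(-p) = 1 = Γ_p(0)²` it says that `Γ_p(x + 2p) Γ_p(x) ≡ Γ_p(x + p)²` at `x = -p`, and
the functional equation propagates this congruence to all `x`
(`sq_dvd_padicGamma_add_two_mul`). A geometric progression whose ratio is `1` modulo `p` is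
arithmetic modulo `p²`.

Everything rests on `Γ_p(m + p ^ N) ≡ Γ_p(m)` modulo `p ^ N` for natural numbers `m`, which is
Gauss's generalization of Wilson's theorem (`dvd_padicGammaNat_pow_sub_one`). It shows that the limit
defining `Γ_p` exists and transfers identities from natural numbers to `ℤ_p`.
-/

/-! ### Morita's Gamma function at natural numbers -/

section Gamma

variable {p : ℕ} [Fact p.Prime]

open Classical in
/-- The factor contributed by `x` to Morita's Gamma function: `x` itself if `x` is a unit of
`ℤ_p`, and `1` otherwise. -/
noncomputable def unitFactor (x : ℤ_[p]) : ℤ_[p] := if (p : ℤ_[p]) ∣ x then 1 else x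

theorem unitFactor_of_dvd {x : ℤ_[p]} (h : (p : ℤ_[p]) ∣ x) : unitFactor x = 1 := if_pos h

theorem unitFactor_of_not_dvd {x : ℤ_[p]} (h : ¬ (p : ℤ_[p]) ∣ x) : unitFactor x = x := if_neg h

theorem PadicInt.isUnit_iff_not_dvd {x : ℤ_[p]} : IsUnit x ↔ ¬ (p : ℤ_[p]) ∣ x := by
  rw [← PadicInt.norm_lt_one_iff_dvd, PadicInt.isUnit_iff, not_lt]
  exact ⟨fun h => h.ge, fun h => le_antisymm (PadicInt.norm_le_one x) h⟩

theorem isUnit_unitFactor (x : ℤ_[p]) : IsUnit (unitFactor x) := by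
  by_cases h : (p : ℤ_[p]) ∣ x
  · rw [unitFactor_of_dvd h]; exact isUnit_one
  · rw [unitFactor_of_not_dvd h]; exact PadicInt.isUnit_iff_not_dvd.2 h

theorem PadicInt.natCast_dvd_natCast_iff {k : ℕ} : (p : ℤ_[p]) ∣ (k : ℤ_[p]) ↔ p ∣ k := by
  have h := PadicInt.pow_p_dvd_int_iff (p := p) 1 (k : ℤ)
  simpa [Int.natCast_dvd_natCast] using h

theorem unitFactor_natCast_of_coprime {k : ℕ} (h : k.Coprime p) :
    unitFactor (k : ℤ_[p]) = k := by
  refine unitFactor_of_not_dvd fun hd => ?_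
  rw [PadicInt.natCast_dvd_natCast_iff] at hd
  exact (Fact.out : p.Prime).coprime_iff_not_dvd.1 h.symm hd

theorem unitFactor_natCast_of_not_coprime {k : ℕ} (h : ¬ k.Coprime p) :
    unitFactor (k : ℤ_[p]) = 1 := by
  refine unitFactor_of_dvd ?_
  rw [PadicInt.natCast_dvd_natCast_iff]
  by_contra hd
  exact h ((Fact.out : p.Prime).coprime_iff_not_dvd.2 hd).symm

theorem dvd_unitFactor_sub {N : ℕ} (hN : N ≠ 0) {x y : ℤ_[p]} (h : (p : ℤ_[p]) ^ N ∣ x - y) :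
    (p : ℤ_[p]) ^ N ∣ unitFactor x - unitFactor y := by
  have h1 : (p : ℤ_[p]) ∣ x - y := (dvd_pow_self _ hN).trans h
  by_cases hy : (p : ℤ_[p]) ∣ y
  · have hx : (p : ℤ_[p]) ∣ x := (dvd_iff_dvd_of_dvd_sub h1).2 hy
    simp [unitFactor_of_dvd hx, unitFactor_of_dvd hy]
  · have hx : ¬ (p : ℤ_[p]) ∣ x := fun hx => hy ((dvd_iff_dvd_of_dvd_sub h1).1 hx)
    rwa [unitFactor_of_not_dvd hx, unitFactor_of_not_dvd hy]

theorem padicGammaNat_zero : padicGammaNat p 0 = 1 := by simp [padicGammaNat]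

theorem padicGammaNat_succ (m : ℕ) :
    padicGammaNat p (m + 1) = -unitFactor (m : ℤ_[p]) * padicGammaNat p m := by
  rcases Nat.eq_zero_or_pos m with rfl | hm
  · have : unitFactor ((0 : ℕ) : ℤ_[p]) = 1 := unitFactor_of_dvd (by simp)
    have hI : Finset.Ioo 0 1 = (∅ : Finset ℕ) := by decide
    rw [this, padicGammaNat_zero]
    simp [padicGammaNat, hI]
  · have hI : Finset.Ioo 0 (m + 1) = insert m (Finset.Ioo 0 m) := by
      ext k; simp only [Finset.mem_Ioo, Finset.mem_insert]; omega
    unfold padicGammaNat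
    rw [hI, Finset.filter_insert]
    split_ifs with hc
    · rw [Finset.prod_insert (by simp), unitFactor_natCast_of_coprime hc]
      ring
    · rw [unitFactor_natCast_of_not_coprime hc]
      ring

theorem isUnit_padicGammaNat (m : ℕ) : IsUnit (padicGammaNat p m) := by
  induction m with
  | zero => rw [padicGammaNat_zero]; exact isUnit_one
  | succ m ih => rw [padicGammaNat_succ]; exact (isUnit_unitFactor _).neg.mul ih

/-- A congruence `Γ_p(d) ≡ Γ_p(0)` modulo `p ^ N`, where `p ^ N ∣ d`, propagates to
`Γ_p(m + d) ≡ Γ_p(m)`. -/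
theorem dvd_padicGammaNat_add_sub {N d : ℕ} (hN : N ≠ 0) (hd : p ^ N ∣ d)
    (h : (p : ℤ_[p]) ^ N ∣ padicGammaNat p d - 1) (m : ℕ) :
    (p : ℤ_[p]) ^ N ∣ padicGammaNat p (m + d) - padicGammaNat p m := by
  induction m with
  | zero => simpa [padicGammaNat_zero] using h
  | succ m ih =>
    rw [show m + 1 + d = (m + d) + 1 by ring, padicGammaNat_succ, padicGammaNat_succ]
    have hu : (p : ℤ_[p]) ^ N ∣ unitFactor ((m + d : ℕ) : ℤ_[p]) - unitFactor (m : ℤ_[p]) := by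
      refine dvd_unitFactor_sub hN ?_
      obtain ⟨c, rfl⟩ := hd
      exact ⟨c, by push_cast; ring⟩
    have := (hu.mul_left (-padicGammaNat p (m + d))).add
      (ih.mul_left (-unitFactor (m : ℤ_[p])))
    convert this using 1
    ring

theorem dvd_padicGammaNat_add_mul_sub {N d : ℕ} (hN : N ≠ 0) (hd : p ^ N ∣ d)
    (h : (p : ℤ_[p]) ^ N ∣ padicGammaNat p d - 1) (m s : ℕ) :
    (p : ℤ_[p]) ^ N ∣ padicGammaNat p (m + d * s) - padicGammaNat p m := by
  induction s with
  | zero => simp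
  | succ s ih =>
    have := (dvd_padicGammaNat_add_sub hN hd h (m + d * s)).add ih
    rw [show m + d * (s + 1) = m + d * s + d by ring]
    convert this using 1
    ring

/-- The product of all units of `ℤ / p ^ N` squares to `1`. -/
theorem dvd_padicGammaNat_pow_sq_sub_one (N : ℕ) (hN : N ≠ 0) :
    (p : ℤ_[p]) ^ N ∣ padicGammaNat p (p ^ N) ^ 2 - 1 := by
  have hp : p.Prime := Fact.out
  have : NeZero (p ^ N) := ⟨pow_ne_zero _ hp.ne_zero⟩
  rw [← Ideal.mem_span_singleton, ← PadicInt.ker_toZModPow, RingHom.mem_ker]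
  have hcop : ∀ k : ℕ, k.Coprime p ↔ k.Coprime (p ^ N) := fun k =>
    (Nat.coprime_pow_right_iff (Nat.pos_of_ne_zero hN) k p).symm
  have hP : ∏ k ∈ (Finset.Ioo 0 (p ^ N)).filter (fun k => Nat.Coprime k p), (k : ZMod (p ^ N))
      = ((∏ v : (ZMod (p ^ N))ˣ, v : (ZMod (p ^ N))ˣ) : ZMod (p ^ N)) := by
    rw [Units.coe_prod]
    symm
    refine Finset.prod_bij (fun v _ => (v : ZMod (p ^ N)).val) ?_ ?_ ?_ ?_
    · intro v _
      have hv := ZMod.val_coe_unit_coprime v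
      rw [Finset.mem_filter, Finset.mem_Ioo]
      refine ⟨⟨Nat.pos_of_ne_zero fun h0 => ?_, ZMod.val_lt _⟩, (hcop _).2 hv⟩
      rw [h0, Nat.coprime_zero_left] at hv
      exact (Nat.one_lt_pow hN hp.one_lt).ne' hv
    · intro v _ w _ h
      exact Units.ext (ZMod.val_injective _ h)
    · intro k hk
      rw [Finset.mem_filter, Finset.mem_Ioo] at hk
      refine ⟨ZMod.unitOfCoprime k ((hcop k).1 hk.2), Finset.mem_univ _, ?_⟩
      rw [ZMod.coe_unitOfCoprime, ZMod.val_natCast_of_lt hk.1.2]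
    · intro v _
      rw [ZMod.natCast_zmod_val]
  have hsq : (∏ v : (ZMod (p ^ N))ˣ, v) ^ 2 = 1 := by
    have h : ∏ v : (ZMod (p ^ N))ˣ, v = ∏ v : (ZMod (p ^ N))ˣ, v⁻¹ :=
      (Equiv.prod_comp (Equiv.inv (ZMod (p ^ N))ˣ) (fun v => v)).symm
    rw [Finset.prod_inv_distrib] at h
    rw [sq]
    nth_rewrite 1 [h]
    exact inv_mul_cancel _
  have hsq' := congrArg (Units.val) hsq
  rw [Units.val_pow_eq_pow_val, ← hP, Units.val_one] at hsq'
  unfold padicGammaNat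
  rw [mul_pow, ← pow_mul, mul_comm (p ^ N) 2, pow_mul, neg_one_sq, one_pow, one_mul, map_sub,
    map_pow, map_prod, map_one]
  simp only [map_natCast]
  rw [hsq', sub_self]

/-- Wilson's theorem. -/
theorem dvd_padicGammaNat_self_sub_one (hp2 : p ≠ 2) :
    (p : ℤ_[p]) ∣ padicGammaNat p p - 1 := by
  have hp : p.Prime := Fact.out
  have hodd : Odd p := hp.odd_of_ne_two hp2
  have hprod : ∏ k ∈ (Finset.Ioo 0 p).filter (fun k => Nat.Coprime k p), (k : ℤ_[p])
      = ((p - 1).factorial : ℕ) := by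
    rw [← Finset.prod_Ico_id_eq_factorial, Nat.cast_prod,
      Nat.sub_add_cancel hp.one_le]
    refine Finset.prod_congr ?_ fun _ _ => rfl
    ext k
    simp only [Finset.mem_filter, Finset.mem_Ioo, Finset.mem_Ico]
    constructor
    · rintro ⟨⟨h0, h1⟩, _⟩
      exact ⟨h0, h1⟩
    · rintro ⟨h0, h1⟩
      exact ⟨⟨h0, h1⟩, (Nat.coprime_of_lt_prime (by omega) h1 hp).symm⟩
  unfold padicGammaNat
  rw [hprod, hodd.neg_one_pow]
  have h : p ∣ (p - 1).factorial + 1 := by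
    rw [← CharP.cast_eq_zero_iff (ZMod p) p]
    push_cast
    rw [ZMod.wilsons_lemma, neg_add_cancel]
  have h2 := PadicInt.natCast_dvd_natCast_iff.2 h
  push_cast at h2
  rw [show (-1 : ℤ_[p]) * ((p - 1).factorial : ℕ) - 1 = -(((p - 1).factorial : ℕ) + 1) by ring]
  exact (dvd_neg).2 h2

theorem isUnit_two (hp2 : p ≠ 2) : IsUnit (2 : ℤ_[p]) := by
  rw [PadicInt.isUnit_iff_not_dvd]
  intro h
  have h' : (p : ℤ_[p]) ∣ ((2 : ℕ) : ℤ_[p]) := by exact_mod_cast h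
  rw [PadicInt.natCast_dvd_natCast_iff, Nat.prime_dvd_prime_iff_eq Fact.out Nat.prime_two] at h'
  exact hp2 h'

/-- Gauss's generalization of Wilson's theorem: the product of the units of `ℤ / p ^ N` is `-1`.
It is a square root of `1`, and `≡ -1` modulo `p`. -/
theorem dvd_padicGammaNat_pow_sub_one (hp2 : p ≠ 2) (N : ℕ) (hN : N ≠ 0) :
    (p : ℤ_[p]) ^ N ∣ padicGammaNat p (p ^ N) - 1 := by
  have h1 : (p : ℤ_[p]) ∣ padicGammaNat p (p ^ N) - 1 := by
    have := dvd_padicGammaNat_add_mul_sub (p := p) (N := 1) (d := p) one_ne_zero (by simp)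
      (by simpa using dvd_padicGammaNat_self_sub_one hp2) 0 (p ^ (N - 1))
    rwa [pow_one, zero_add, padicGammaNat_zero, ← pow_succ',
      Nat.sub_add_cancel (Nat.pos_of_ne_zero hN)] at this
  have hu : IsUnit (padicGammaNat p (p ^ N) + 1) := by
    rw [PadicInt.isUnit_iff_not_dvd]
    intro h
    refine PadicInt.isUnit_iff_not_dvd.1 (isUnit_two hp2) ?_
    have := dvd_sub h h1
    convert this using 1
    ring
  have h2 := dvd_padicGammaNat_pow_sq_sub_one (p := p) N hN
  rw [show padicGammaNat p (p ^ N) ^ 2 - 1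
    = (padicGammaNat p (p ^ N) - 1) * (padicGammaNat p (p ^ N) + 1) by ring] at h2
  exact hu.dvd_mul_right.1 h2

theorem dvd_padicGammaNat_sub (hp2 : p ≠ 2) {N : ℕ} (hN : N ≠ 0) {m k : ℕ}
    (h : (p : ℤ_[p]) ^ N ∣ (m : ℤ_[p]) - k) :
    (p : ℤ_[p]) ^ N ∣ padicGammaNat p m - padicGammaNat p k := by
  wlog hmk : k ≤ m generalizing m k
  · rw [dvd_sub_comm]
    exact this ((dvd_sub_comm).1 h) (le_of_not_ge hmk)
  have h' : p ^ N ∣ m - k := by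
    have := (PadicInt.pow_p_dvd_int_iff (p := p) N ((m : ℤ) - k)).1 (by push_cast; exact h)
    rw [← Nat.cast_sub hmk] at this
    exact_mod_cast this
  obtain ⟨s, hs⟩ := h'
  rw [show m = k + p ^ N * s by omega]
  exact dvd_padicGammaNat_add_mul_sub hN dvd_rfl (dvd_padicGammaNat_pow_sub_one hp2 N hN) k s

/-! ### Morita's Gamma function on the `p`-adic integers -/

theorem PadicInt.pow_dvd_iff_norm_le {N : ℕ} {x : ℤ_[p]} :
    (p : ℤ_[p]) ^ N ∣ x ↔ ‖x‖ ≤ (p : ℝ) ^ (-(N : ℤ)) := by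
  rw [PadicInt.norm_le_pow_iff_mem_span_pow, Ideal.mem_span_singleton]

theorem PadicInt.exists_nat_dvd_sub (N : ℕ) (x : ℤ_[p]) :
    ∃ m : ℕ, (p : ℤ_[p]) ^ N ∣ x - m :=
  ⟨x.appr N, Ideal.mem_span_singleton.1 (PadicInt.appr_spec N x)⟩

theorem PadicInt.eq_of_forall_pow_dvd_sub {x y : ℤ_[p]}
    (h : ∀ N : ℕ, N ≠ 0 → (p : ℤ_[p]) ^ N ∣ x - y) : x = y := by
  rw [← PadicInt.ext_of_toZModPow]
  intro N
  rw [← sub_eq_zero, ← map_sub, ← RingHom.mem_ker, PadicInt.ker_toZModPow,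
    Ideal.mem_span_singleton]
  rcases eq_or_ne N 0 with rfl | hN
  · simp
  · exact h N hN

theorem PadicInt.eventually_pow_dvd_sub (N : ℕ) (x : ℤ_[p]) :
    ∀ᶠ y in 𝓝 x, (p : ℤ_[p]) ^ N ∣ y - x := by
  have hpos : (0 : ℝ) < (p : ℝ) ^ (-(N : ℤ)) :=
    zpow_pos (by exact_mod_cast (Fact.out : p.Prime).pos) _
  filter_upwards [Metric.ball_mem_nhds x hpos] with y hy
  rw [PadicInt.pow_dvd_iff_norm_le, ← dist_eq_norm]
  exact (Metric.mem_ball.1 hy).le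

theorem PadicInt.comap_natCast_nhds_neBot (x : ℤ_[p]) :
    (comap (Nat.cast : ℕ → ℤ_[p]) (𝓝 x)).NeBot := by
  refine comap_neBot fun t ht => ?_
  obtain ⟨y, hy, m, rfl⟩ := mem_closure_iff_nhds.1 (PadicInt.denseRange_natCast x) t ht
  exact ⟨m, hy⟩

/-- The limit defining `Γ_p` exists. -/
theorem tendsto_padicGammaNat (hp2 : p ≠ 2) (x : ℤ_[p]) :
    Tendsto (padicGammaNat p) (comap (Nat.cast : ℕ → ℤ_[p]) (𝓝 x)) (𝓝 (padicGamma p x)) := by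
  have := PadicInt.comap_natCast_nhds_neBot x
  have hc : Cauchy (map (padicGammaNat p) (comap (Nat.cast : ℕ → ℤ_[p]) (𝓝 x))) := by
    rw [Metric.cauchy_iff]
    refine ⟨inferInstance, fun ε hε => ?_⟩
    obtain ⟨N, hN⟩ := PadicInt.exists_pow_neg_lt p hε
    refine ⟨_, image_mem_map (preimage_mem_comap (PadicInt.eventually_pow_dvd_sub (N + 1) x)), ?_⟩
    rintro _ ⟨m, hm, rfl⟩ _ ⟨k, hk, rfl⟩
    have hmk : (p : ℤ_[p]) ^ (N + 1) ∣ (m : ℤ_[p]) - k := by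
      have := dvd_sub (Set.mem_ofPred.1 hm) (Set.mem_ofPred.1 hk)
      convert this using 1
      ring
    have h := (pow_dvd_pow _ N.le_succ).trans (dvd_padicGammaNat_sub hp2 N.succ_ne_zero hmk)
    rw [dist_eq_norm]
    exact (PadicInt.pow_dvd_iff_norm_le.1 h).trans_lt hN
  obtain ⟨L, hL⟩ := CompleteSpace.complete hc
  exact tendsto_nhds_limUnder ⟨L, hL⟩

/-- `Γ_p` is determined modulo `p ^ N` by its values at natural numbers. -/
theorem dvd_padicGamma_sub_nat (hp2 : p ≠ 2) {N : ℕ} (hN : N ≠ 0) {x : ℤ_[p]} {m : ℕ}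
    (h : (p : ℤ_[p]) ^ N ∣ x - m) :
    (p : ℤ_[p]) ^ N ∣ padicGamma p x - padicGammaNat p m := by
  have := PadicInt.comap_natCast_nhds_neBot x
  rw [PadicInt.pow_dvd_iff_norm_le]
  refine le_of_tendsto (((tendsto_padicGammaNat hp2 x).sub_const (padicGammaNat p m)).norm) ?_
  filter_upwards [preimage_mem_comap (PadicInt.eventually_pow_dvd_sub N x)] with k hk
  rw [← PadicInt.pow_dvd_iff_norm_le]
  refine dvd_padicGammaNat_sub hp2 hN ?_
  have := (Set.mem_ofPred.1 hk).add h
  convert this using 1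
  ring

theorem dvd_padicGamma_sub (hp2 : p ≠ 2) {N : ℕ} (hN : N ≠ 0) {x y : ℤ_[p]}
    (h : (p : ℤ_[p]) ^ N ∣ x - y) :
    (p : ℤ_[p]) ^ N ∣ padicGamma p x - padicGamma p y := by
  obtain ⟨m, hm⟩ := PadicInt.exists_nat_dvd_sub N y
  have hx : (p : ℤ_[p]) ^ N ∣ x - m := by
    have := h.add hm
    convert this using 1
    ring
  have := dvd_sub (dvd_padicGamma_sub_nat hp2 hN hx) (dvd_padicGamma_sub_nat hp2 hN hm)
  convert this using 1
  ring

theorem padicGamma_natCast (hp2 : p ≠ 2) (m : ℕ) :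
    padicGamma p (m : ℤ_[p]) = padicGammaNat p m :=
  PadicInt.eq_of_forall_pow_dvd_sub fun N hN => dvd_padicGamma_sub_nat hp2 hN (by simp)

theorem padicGamma_zero (hp2 : p ≠ 2) : padicGamma p 0 = 1 := by
  have := padicGamma_natCast (p := p) hp2 0
  rwa [Nat.cast_zero, padicGammaNat_zero] at this

/-- The functional equation of `Γ_p`. -/
theorem padicGamma_add_one (hp2 : p ≠ 2) (x : ℤ_[p]) :
    padicGamma p (x + 1) = -unitFactor x * padicGamma p x := by
  refine PadicInt.eq_of_forall_pow_dvd_sub fun N hN => ?_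
  obtain ⟨m, hm⟩ := PadicInt.exists_nat_dvd_sub N x
  have h1 := dvd_padicGamma_sub_nat (x := x + 1) (m := m + 1) hp2 hN (by
    push_cast; rwa [add_sub_add_right_eq_sub])
  rw [padicGammaNat_succ] at h1
  have h2 := dvd_padicGamma_sub_nat hp2 hN hm
  have h3 := dvd_unitFactor_sub hN hm
  have := (h1.add (h2.mul_left (unitFactor (m : ℤ_[p])))).add (h3.mul_left (padicGamma p x))
  convert this using 1
  ring

theorem isUnit_padicGamma (hp2 : p ≠ 2) (x : ℤ_[p]) : IsUnit (padicGamma p x) := by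
  obtain ⟨m, hm⟩ := PadicInt.exists_nat_dvd_sub 1 x
  have h := dvd_padicGamma_sub_nat hp2 one_ne_zero hm
  rw [pow_one] at h
  rw [PadicInt.isUnit_iff_not_dvd, dvd_iff_dvd_of_dvd_sub h, ← PadicInt.isUnit_iff_not_dvd]
  exact isUnit_padicGammaNat m

/-! ### The reflection formula -/

theorem PadicInt.pow_dvd_sub_iff {N : ℕ} {x y : ℤ_[p]} :
    (p : ℤ_[p]) ^ N ∣ x - y ↔ PadicInt.toZModPow N x = PadicInt.toZModPow N y := by
  rw [← sub_eq_zero, ← map_sub, ← RingHom.mem_ker, PadicInt.ker_toZModPow,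
    Ideal.mem_span_singleton]

theorem padicGamma_mul_one_sub_of_dvd (hp2 : p ≠ 2) {x : ℤ_[p]} (hx : (p : ℤ_[p]) ∣ x) :
    padicGamma p (x + 1) * padicGamma p (1 - (x + 1)) =
      padicGamma p x * padicGamma p (1 - x) := by
  rw [show 1 - (x + 1) = -x by ring, show 1 - x = -x + 1 by ring, padicGamma_add_one hp2,
    padicGamma_add_one hp2, unitFactor_of_dvd hx, unitFactor_of_dvd ((dvd_neg).2 hx)]
  ring

theorem padicGamma_mul_one_sub_of_not_dvd (hp2 : p ≠ 2) {x : ℤ_[p]} (hx : ¬ (p : ℤ_[p]) ∣ x) :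
    padicGamma p (x + 1) * padicGamma p (1 - (x + 1)) =
      -(padicGamma p x * padicGamma p (1 - x)) := by
  rw [show 1 - (x + 1) = -x by ring, show 1 - x = -x + 1 by ring, padicGamma_add_one hp2,
    padicGamma_add_one hp2, unitFactor_of_not_dvd hx,
    unitFactor_of_not_dvd (fun h => hx ((dvd_neg).1 h))]
  ring

/-- If `p ∣ x`, moving through the residue classes from `x + 1` to `x + p` changes the sign of
`Γ_p(y) Γ_p(1 - y)` at each step. -/
theorem padicGamma_mul_one_sub_add (hp2 : p ≠ 2) {x : ℤ_[p]} (hx : (p : ℤ_[p]) ∣ x) {i : ℕ}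
    (hi : i < p) :
    padicGamma p (x + (i + 1)) * padicGamma p (1 - (x + (i + 1))) =
      (-1) ^ i * (padicGamma p x * padicGamma p (1 - x)) := by
  induction i with
  | zero =>
    rw [Nat.cast_zero, zero_add, padicGamma_mul_one_sub_of_dvd hp2 hx]
    ring
  | succ i ih =>
    have hnd : ¬ (p : ℤ_[p]) ∣ x + (i + 1) := by
      rw [dvd_add_right hx]
      have : ¬ (p : ℤ_[p]) ∣ ((i + 1 : ℕ) : ℤ_[p]) := by
        rw [PadicInt.natCast_dvd_natCast_iff]
        exact Nat.not_dvd_of_pos_of_lt i.succ_pos hi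
      simpa using this
    rw [Nat.cast_succ, ← add_assoc x, padicGamma_mul_one_sub_of_not_dvd hp2 hnd,
      ih (by omega)]
    ring

/-- The reflection formula `Γ_p(x) Γ_p(1 - x) = -1` on the residue disc of `0`. -/
theorem padicGamma_mul_one_sub_eq_neg_one (hp2 : p ≠ 2) (z : ℤ_[p]) :
    padicGamma p (p * z) * padicGamma p (1 - p * z) = -1 := by
  have hp : p.Prime := Fact.out
  have hnat : ∀ s : ℕ, padicGamma p (p * s) * padicGamma p (1 - p * s) = -1 := by
    intro s
    induction s with
    | zero =>
      have h1 := padicGamma_add_one hp2 (0 : ℤ_[p])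
      rw [unitFactor_of_dvd (dvd_zero _), zero_add, padicGamma_zero hp2] at h1
      rw [Nat.cast_zero, mul_zero, sub_zero, padicGamma_zero hp2, h1]
      ring
    | succ s ih =>
      have h := padicGamma_mul_one_sub_add hp2 (x := p * s) (dvd_mul_right _ _) (i := p - 1)
        (Nat.sub_lt hp.pos one_pos)
      have hc : (((p - 1 : ℕ) : ℤ_[p]) + 1) = p := by
        rw [← Nat.cast_succ, Nat.succ_eq_add_one, Nat.sub_add_cancel hp.one_le]
      rw [hc, (hp.even_sub_one hp2).neg_one_pow, one_mul, ih] at h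
      rw [Nat.cast_succ, mul_add, mul_one, h]
  refine PadicInt.eq_of_forall_pow_dvd_sub fun N hN => ?_
  obtain ⟨s, hs⟩ := PadicInt.exists_nat_dvd_sub N z
  have h1 := dvd_padicGamma_sub (x := p * z) (y := p * s) hp2 hN (by
    rw [← mul_sub]; exact hs.mul_left _)
  have h2 := dvd_padicGamma_sub (x := 1 - p * z) (y := 1 - p * s) hp2 hN (by
    rw [show 1 - (p : ℤ_[p]) * z - (1 - p * s) = -p * (z - s) by ring]; exact hs.mul_left _)
  rw [PadicInt.pow_dvd_sub_iff] at h1 h2 ⊢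
  rw [map_mul, h1, h2, ← map_mul, hnat]

theorem padicHalf_one_add_self (hp2 : p ≠ 2) :
    padicHalf (1 : ℤ_[p]) + padicHalf 1 = 1 := by
  rw [← two_mul, two_mul_padicHalf hp2]

theorem padicGamma_half_sq (hp2 : p ≠ 2) :
    padicGamma p (padicHalf 1) ^ 2 = (-1) ^ ((p + 1) / 2) := by
  have hp : p.Prime := Fact.out
  obtain ⟨i, hi⟩ := hp.odd_of_ne_two hp2
  have hh := padicHalf_one_add_self hp2
  have hpc : (p : ℤ_[p]) = 2 * i + 1 := by exact_mod_cast congrArg (Nat.cast (R := ℤ_[p])) hi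
  -- `1 / 2 = -p / 2 + (p + 1) / 2`
  have he : (p : ℤ_[p]) * (-padicHalf 1) + ((i : ℤ_[p]) + 1) = padicHalf (1 : ℤ_[p]) := by
    rw [hpc]
    linear_combination (-(i : ℤ_[p]) - 1) * hh
  have h := padicGamma_mul_one_sub_add hp2 (x := (p : ℤ_[p]) * (-padicHalf (1 : ℤ_[p])))
    (dvd_mul_right _ _) (i := i) (by omega)
  rw [he, padicGamma_mul_one_sub_eq_neg_one hp2,
    show (1 : ℤ_[p]) - padicHalf 1 = padicHalf 1 by linear_combination -hh] at h
  rw [sq, h, show (p + 1) / 2 = i + 1 by omega, pow_succ]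

/-! ### `Γ_p` modulo `p ^ 2` on a residue disc -/

/-- Modulo `p ^ 2`, the values of `Γ_p` along an arithmetic progression of difference `p` form a
geometric progression. At `x = -p` this is the reflection formula `Γ_p(p) Γ_p(-p) = 1`, and the
functional equation carries it from `x` to `x + 1` because `(x + 2 p) x = (x + p) ^ 2 - p ^ 2`. -/
theorem sq_dvd_padicGamma_add_two_mul (hp2 : p ≠ 2) (x : ℤ_[p]) :
    (p : ℤ_[p]) ^ 2 ∣
      padicGamma p (x + 2 * p) * padicGamma p x - padicGamma p (x + p) ^ 2 := by
  have hnat : ∀ m : ℕ, (p : ℤ_[p]) ^ 2 ∣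
      padicGamma p (-p + m + 2 * p) * padicGamma p (-p + m) - padicGamma p (-p + m + p) ^ 2 := by
    intro m
    induction m with
    | zero =>
      have h := padicGamma_mul_one_sub_eq_neg_one hp2 (-1 : ℤ_[p])
      have h1 := padicGamma_add_one hp2 (p : ℤ_[p])
      rw [unitFactor_of_dvd dvd_rfl] at h1
      rw [mul_neg_one, show (1 : ℤ_[p]) - -p = p + 1 by ring, h1] at h
      rw [Nat.cast_zero, add_zero, show -(p : ℤ_[p]) + 2 * p = p by ring, neg_add_cancel,
        padicGamma_zero hp2,
        show padicGamma p (p : ℤ_[p]) * padicGamma p (-p) - 1 ^ 2 = 0 by linear_combination -h]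
      exact dvd_zero _
    | succ m ih =>
      set y : ℤ_[p] := -p + m with hy
      have hu : (p : ℤ_[p]) ^ 2 ∣ unitFactor (y + 2 * (p : ℤ_[p])) * unitFactor y -
          unitFactor (y + (p : ℤ_[p])) ^ 2 := by
        by_cases hd : (p : ℤ_[p]) ∣ y
        · rw [unitFactor_of_dvd hd, unitFactor_of_dvd (hd.add (dvd_mul_left _ _)),
            unitFactor_of_dvd (hd.add dvd_rfl)]
          simp
        · rw [unitFactor_of_not_dvd hd,
            unitFactor_of_not_dvd (by rwa [dvd_add_left (dvd_mul_left _ _)]),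
            unitFactor_of_not_dvd (by rwa [dvd_add_left dvd_rfl])]
          exact ⟨-1, by ring⟩
      have := (hu.mul_right (padicGamma p (y + 2 * p) * padicGamma p y)).add
        (ih.mul_left (unitFactor (y + (p : ℤ_[p])) ^ 2))
      rw [Nat.cast_succ, ← add_assoc, ← hy, show y + 1 + 2 * (p : ℤ_[p]) = y + 2 * p + 1 by ring,
        show y + 1 + (p : ℤ_[p]) = y + p + 1 by ring, padicGamma_add_one hp2,
        padicGamma_add_one hp2, padicGamma_add_one hp2]
      convert this using 1
      ring
  obtain ⟨m, hm⟩ := PadicInt.exists_nat_dvd_sub 2 (x + (p : ℤ_[p]))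
  have hper : ∀ d : ℤ_[p], PadicInt.toZModPow 2 (padicGamma p (-p + m + d)) =
      PadicInt.toZModPow 2 (padicGamma p (x + d)) := by
    intro d
    rw [← PadicInt.pow_dvd_sub_iff]
    refine dvd_padicGamma_sub hp2 two_ne_zero ?_
    rw [show -p + m + d - (x + d) = -(x + p - m : ℤ_[p]) by ring]
    exact (dvd_neg).2 hm
  have h := hnat m
  have hper0 := hper 0
  rw [add_zero, add_zero] at hper0
  rw [PadicInt.pow_dvd_sub_iff, map_mul, map_pow] at h ⊢
  rwa [← hper, ← hper, ← hper0]

theorem dvd_padicGamma_add_sub (hp2 : p ≠ 2) (x : ℤ_[p]) :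
    (p : ℤ_[p]) ∣ padicGamma p (x + p) - padicGamma p x := by
  simpa using dvd_padicGamma_sub (N := 1) (x := x + p) (y := x) hp2 one_ne_zero (by simp)

/-- A geometric progression with ratio `≡ 1` modulo `p` is arithmetic modulo `p ^ 2`. -/
theorem sq_dvd_padicGamma_second_difference (hp2 : p ≠ 2) (x : ℤ_[p]) :
    (p : ℤ_[p]) ^ 2 ∣
      padicGamma p (x + 2 * p) - padicGamma p (x + p) -
        (padicGamma p (x + p) - padicGamma p x) := by
  rw [← (isUnit_padicGamma hp2 x).dvd_mul_right]
  have := (sq_dvd_padicGamma_add_two_mul hp2 x).add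
    (pow_dvd_pow_of_dvd (dvd_padicGamma_add_sub hp2 x) 2)
  convert this using 1
  ring

/-- A function on `ℤ_p` is linear modulo `p ^ 2` with slope divisible by `p` if
`f s ≡ f 0 + p c s` modulo `p ^ 2` for some `c` and all `s`. -/
def IsLinearModSq (f : ℤ_[p] → ℤ_[p]) : Prop :=
  ∃ c : ℤ_[p], ∀ s : ℤ_[p], (p : ℤ_[p]) ^ 2 ∣ f s - (f 0 + p * c * s)

theorem IsLinearModSq.mul {f g : ℤ_[p] → ℤ_[p]} (hf : IsLinearModSq f) (hg : IsLinearModSq g) :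
    IsLinearModSq fun s => f s * g s := by
  obtain ⟨c, hc⟩ := hf
  obtain ⟨d, hd⟩ := hg
  refine ⟨f 0 * d + g 0 * c, fun s => ?_⟩
  have := (((hc s).mul_right (g s)).add ((hd s).mul_left (f 0 + p * c * s))).add
    (dvd_mul_right ((p : ℤ_[p]) ^ 2) (c * d * s ^ 2))
  convert this using 1
  ring

theorem IsLinearModSq.const_mul {f : ℤ_[p] → ℤ_[p]} (hf : IsLinearModSq f) (b : ℤ_[p]) :
    IsLinearModSq fun s => b * f s :=
  IsLinearModSq.mul ⟨0, fun s => by simp⟩ hf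

theorem IsLinearModSq.comp_mul {f : ℤ_[p] → ℤ_[p]} (hf : IsLinearModSq f) (w : ℤ_[p]) :
    IsLinearModSq fun s => f (w * s) := by
  obtain ⟨c, hc⟩ := hf
  refine ⟨c * w, fun s => ?_⟩
  have := hc (w * s)
  simp only [mul_zero]
  convert this using 1
  ring

/-- Functions that are linear modulo `p ^ 2` and agree at `0` and `-1` agree everywhere. -/
theorem IsLinearModSq.sq_dvd_sub {f g : ℤ_[p] → ℤ_[p]} (hf : IsLinearModSq f)
    (hg : IsLinearModSq g) (h0 : f 0 = g 0) (h1 : f (-1) = g (-1)) (s : ℤ_[p]) :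
    (p : ℤ_[p]) ^ 2 ∣ f s - g s := by
  obtain ⟨c, hc⟩ := hf
  obtain ⟨d, hd⟩ := hg
  have h := (dvd_sub (hc s) (hd s)).add ((dvd_sub (hc (-1)) (hd (-1))).mul_right s)
  rw [h1, h0] at h
  convert h using 1
  ring

/-- The second differences vanish modulo `p ^ 2`, which gives the claim for natural `s`; for general
`s` the value modulo `p ^ 2` depends on `s` modulo `p ^ 2` only. -/
theorem isLinearModSq_padicGamma (hp2 : p ≠ 2) (x : ℤ_[p]) :
    IsLinearModSq fun s => padicGamma p (x + p * s) := by
  have hdiff : ∀ s : ℕ, (p : ℤ_[p]) ^ 2 ∣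
      padicGamma p (x + p * s + p) - padicGamma p (x + p * s) -
        (padicGamma p (x + p) - padicGamma p x) := by
    intro s
    induction s with
    | zero => simp
    | succ s ih =>
      have := (sq_dvd_padicGamma_second_difference hp2 (x + p * s)).add ih
      rw [Nat.cast_succ, show x + p * ((s : ℤ_[p]) + 1) = x + p * s + p by ring,
        show x + p * (s : ℤ_[p]) + p + p = x + p * s + 2 * p by ring]
      convert this using 1
      ring
  have hnat : ∀ s : ℕ, (p : ℤ_[p]) ^ 2 ∣ padicGamma p (x + p * s) -
      (padicGamma p x + (padicGamma p (x + p) - padicGamma p x) * s) := by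
    intro s
    induction s with
    | zero => simp
    | succ s ih =>
      have := (hdiff s).add ih
      rw [Nat.cast_succ, show x + p * ((s : ℤ_[p]) + 1) = x + p * s + p by ring]
      convert this using 1
      ring
  obtain ⟨c, hc⟩ := dvd_padicGamma_add_sub hp2 x
  refine ⟨c, fun z => ?_⟩
  obtain ⟨s, hs⟩ := PadicInt.exists_nat_dvd_sub 2 z
  have h1 := dvd_padicGamma_sub (x := x + p * z) (y := x + p * s) hp2 two_ne_zero (by
    rw [add_sub_add_left_eq_sub, ← mul_sub]; exact hs.mul_left _)
  have h2 := hnat s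
  rw [hc] at h2
  have := dvd_sub (h1.add h2) (hs.mul_left (p * c))
  simp only [mul_zero, add_zero]
  convert this using 1
  ring

theorem isLinearModSq_polynomial_eval (Q : Polynomial ℤ_[p]) (x : ℤ_[p]) :
    IsLinearModSq fun s => Q.eval (x + (p : ℤ_[p]) * s) := by
  refine ⟨Q.derivative.eval x, fun s => ?_⟩
  obtain ⟨k, hk⟩ := Q.binomExpansion x (p * s)
  simp only [hk, mul_zero, add_zero]
  exact ⟨k * s ^ 2, by ring⟩

end Gamma

/-! ### The hypergeometric sum -/

section Hypergeometric

variable {K : Type*} [Field K]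

/-- The `k`-th term of `₃F₂(1/2, -x, x + 1; 1, 1; 1)`, with the Pochhammer symbols
`(-x)_k (x + 1)_k` written as a product that is visibly symmetric under `x ↦ -1 - x`. -/
noncomputable def hypergeometricTerm (x : K) (k : ℕ) : K :=
  (∏ j ∈ Finset.range k, (1 / 2 + (j : K))) / (k.factorial : K) ^ 3 *
    ∏ j ∈ Finset.range k, ((j : K) - x) * (x + 1 + j)

theorem hypergeometricTerm_symm (x : K) (k : ℕ) :
    hypergeometricTerm (-1 - x) k = hypergeometricTerm x k := by
  unfold hypergeometricTerm
  congr 1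
  exact Finset.prod_congr rfl fun j _ => by ring

theorem eval_ascPochhammer_eq_prod (x : K) (k : ℕ) :
    (ascPochhammer K k).eval x = ∏ j ∈ Finset.range k, (x + j) := by
  induction k with
  | zero => simp
  | succ k ih => rw [ascPochhammer_succ_eval, ih, Finset.prod_range_succ]

theorem truncatedHypergeometric_eq_sum (x : K) (n : ℕ) :
    truncatedHypergeometric [(1 / 2 : K), -x, x + 1] [1, 1] 1 n =
      ∑ k ∈ Finset.range (n + 1), hypergeometricTerm x k := by
  unfold truncatedHypergeometric
  refine Finset.sum_congr rfl fun k _ => ?_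
  have h1 : (ascPochhammer K k).eval 1 = (k.factorial : K) := by
    simp
  have h2 : ∏ j ∈ Finset.range k, (-x + (j : K)) = ∏ j ∈ Finset.range k, ((j : K) - x) :=
    Finset.prod_congr rfl fun _ _ => by ring
  simp only [List.map_cons, List.map_nil, List.prod_cons, List.prod_nil, mul_one, h1, one_pow]
  simp only [eval_ascPochhammer_eq_prod, hypergeometricTerm, Finset.prod_mul_distrib, h2]
  simp only [div_eq_mul_inv, mul_inv, one_mul, ← inv_pow]
  ring

/-- The relation, found by Zeilberger's algorithm, between the partial sums at `x` and at `x + 2`.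
The right-hand side is written with the two Pochhammer symbols `(-x - 1)_{n} (x + 2)_{n}`. -/
theorem sum_hypergeometricTerm_add_two [CharZero K] (x : K) (n : ℕ) :
    (x + 2) ^ 2 * ∑ k ∈ Finset.range (n + 1), hypergeometricTerm (x + 2) k -
      (x + 1) ^ 2 * ∑ k ∈ Finset.range (n + 1), hypergeometricTerm x k =
    2 * (2 * x + 3) * (∏ j ∈ Finset.range (n + 1), (1 / 2 + (j : K))) / (n.factorial : K) ^ 3 *
      ∏ j ∈ Finset.range n, ((j : K) - (x + 1)) * (x + 2 + j) := by
  have h1 : ∀ n : ℕ,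
      (∏ j ∈ Finset.range (n + 1), ((j : K) - (x + 2)) * (x + 2 + 1 + j)) =
        (∏ j ∈ Finset.range n, ((j : K) - (x + 1)) * (x + 2 + j)) *
          (-(x + 2 + n) * (x + 3 + n)) := by
    intro n
    induction n with
    | zero =>
      simp only [zero_add, Finset.prod_range_one, Finset.prod_range_zero, Nat.cast_zero]
      ring
    | succ n ih => rw [Finset.prod_range_succ, ih, Finset.prod_range_succ]; push_cast; ring
  have h2 : ∀ n : ℕ,
      (∏ j ∈ Finset.range (n + 1), ((j : K) - x) * (x + 1 + j)) =
        (∏ j ∈ Finset.range n, ((j : K) - (x + 1)) * (x + 2 + j)) *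
          (-((n : K) - (x + 1)) * (n - x)) := by
    intro n
    induction n with
    | zero =>
      simp only [zero_add, Finset.prod_range_one, Finset.prod_range_zero, Nat.cast_zero]
      ring
    | succ n ih => rw [Finset.prod_range_succ, ih, Finset.prod_range_succ]; push_cast; ring
  induction n with
  | zero => simp [hypergeometricTerm]; ring
  | succ n ih =>
    have hn : (n : K) + 1 ≠ 0 := by exact_mod_cast n.succ_ne_zero
    have hf : (n.factorial : K) ≠ 0 := by exact_mod_cast n.factorial_ne_zero
    rw [Finset.sum_range_succ, Finset.sum_range_succ _ (n + 1), mul_add, mul_add,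
      add_sub_add_comm, ih, hypergeometricTerm, hypergeometricTerm, h1, h2,
      Finset.prod_range_succ (fun j => 1 / 2 + (j : K)) (n + 1),
      Finset.prod_range_succ (fun j => ((j : K) - (x + 1)) * (x + 2 + j)) n, Nat.factorial_succ]
    push_cast
    generalize ∏ j ∈ Finset.range (n + 1), (1 / 2 + (j : K)) = H
    generalize ∏ j ∈ Finset.range n, ((j : K) - (x + 1)) * (x + 2 + j) = Q
    field_simp
    ring

end Hypergeometric

/-! ### Comparison of the two sides -/

section Comparison

variable {p : ℕ} [Fact p.Prime]

/-- The right-hand side of the congruence, as a function of `a`. -/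
noncomputable def gammaProduct (p : ℕ) [Fact p.Prime] (x : ℤ_[p]) : ℤ_[p] :=
  (-1) ^ ((p + 1) / 2) * padicGamma p (padicHalf (-x)) ^ 2 *
    padicGamma p (padicHalf (x + 1)) ^ 2

theorem gammaProduct_symm (x : ℤ_[p]) : gammaProduct p (-1 - x) = gammaProduct p x := by
  unfold gammaProduct
  rw [show -(-1 - x) = x + 1 by ring, show -1 - x + 1 = -x by ring]
  ring

theorem isLinearModSq_gammaProduct (hp2 : p ≠ 2) (x : ℤ_[p]) :
    IsLinearModSq fun s => gammaProduct p (x + p * s) := by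
  have h1 := (isLinearModSq_padicGamma hp2 (padicHalf (-x))).comp_mul (-padicHalf 1)
  have h2 := (isLinearModSq_padicGamma hp2 (padicHalf (x + 1))).comp_mul (padicHalf 1)
  have h := ((h1.mul h1).mul (h2.mul h2)).const_mul ((-1) ^ ((p + 1) / 2))
  convert h using 2 with s
  have e1 : padicHalf (-(x + (p : ℤ_[p]) * s)) =
      padicHalf (-x) + (p : ℤ_[p]) * (-padicHalf 1 * s) := by
    unfold padicHalf; ring
  have e2 : padicHalf (x + (p : ℤ_[p]) * s + 1) =
      padicHalf (x + 1) + (p : ℤ_[p]) * (padicHalf 1 * s) := by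
    unfold padicHalf; ring
  simp only [gammaProduct, e1, e2]
  ring

/-- The coefficients `(1/2)_k / k!³`, `k < p`, are `p`-integral, so the truncated series is a
polynomial in `x` over `ℤ_p`. -/
theorem exists_polynomial_eval_eq_sum (hp2 : p ≠ 2) :
    ∃ Q : Polynomial ℤ_[p], ∀ x : ℤ_[p], ((Q.eval x : ℤ_[p]) : ℚ_[p]) =
      ∑ k ∈ Finset.range p, hypergeometricTerm (x : ℚ_[p]) k := by
  have hp : p.Prime := Fact.out
  have hhalf : ((padicHalf 1 : ℤ_[p]) : ℚ_[p]) = 1 / 2 := by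
    have h := congrArg (fun z : ℤ_[p] => (z : ℚ_[p])) (padicHalf_one_add_self hp2)
    simp only [PadicInt.coe_add, PadicInt.coe_one] at h
    linear_combination h / 2
  have hc : ∀ k : ℕ, ∃ c : ℤ_[p], k < p → (c : ℚ_[p]) =
      (∏ j ∈ Finset.range k, (1 / 2 + (j : ℚ_[p]))) / (k.factorial : ℚ_[p]) ^ 3 := by
    intro k
    by_cases hk : k < p
    · have hu : IsUnit ((k.factorial : ℕ) : ℤ_[p]) := by
        rw [PadicInt.isUnit_iff_not_dvd, PadicInt.natCast_dvd_natCast_iff, hp.dvd_factorial]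
        omega
      obtain ⟨v, hv⟩ := hu.exists_right_inv
      have hv' : (k.factorial : ℚ_[p]) * v = 1 := by
        exact_mod_cast congrArg (fun z : ℤ_[p] => (z : ℚ_[p])) hv
      refine ⟨(∏ j ∈ Finset.range k, (padicHalf 1 + (j : ℤ_[p]))) * v ^ 3, fun _ => ?_⟩
      have hf : (k.factorial : ℚ_[p]) ≠ 0 := by exact_mod_cast k.factorial_ne_zero
      rw [eq_div_iff (pow_ne_zero _ hf)]
      have hprod : ((∏ j ∈ Finset.range k, (padicHalf 1 + (j : ℤ_[p])) : ℤ_[p]) : ℚ_[p]) =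
          ∏ j ∈ Finset.range k, (1 / 2 + (j : ℚ_[p])) := by
        change PadicInt.Coe.ringHom _ = _
        rw [map_prod]
        refine Finset.prod_congr rfl fun j _ => ?_
        change ((padicHalf 1 + (j : ℤ_[p]) : ℤ_[p]) : ℚ_[p]) = _
        rw [PadicInt.coe_add, hhalf, PadicInt.coe_natCast]
      rw [PadicInt.coe_mul, PadicInt.coe_pow, hprod, mul_assoc, ← mul_pow, mul_comm (v : ℚ_[p]),
        hv', one_pow, mul_one]
    · exact ⟨0, fun h => absurd h hk⟩
  choose c hc using hc
  refine ⟨∑ k ∈ Finset.range p, Polynomial.C (c k) * ∏ j ∈ Finset.range k,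
    (Polynomial.C (j : ℤ_[p]) - Polynomial.X) * (Polynomial.X + 1 + Polynomial.C (j : ℤ_[p])),
    fun x => ?_⟩
  change PadicInt.Coe.ringHom _ = _
  rw [Polynomial.eval_finsetSum, map_sum]
  refine Finset.sum_congr rfl fun k hk => ?_
  rw [hypergeometricTerm, ← hc k (Finset.mem_range.1 hk)]
  simp only [Polynomial.eval_mul, Polynomial.eval_C, Polynomial.eval_prod, Polynomial.eval_sub,
    Polynomial.eval_add, Polynomial.eval_X, Polynomial.eval_one, map_mul, map_prod, map_sub,
    map_add, map_one, map_natCast, Polynomial.eval_natCast]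
  rfl

/-- For natural `n` the boundary term of the telescoped recurrence vanishes, since the range of
summation contains every nonzero term. -/
theorem sq_mul_sum_hypergeometricTerm {K : Type*} [Field K] [CharZero K] {n N : ℕ}
    (h : n + 2 < N) :
    ((n : K) + 2) ^ 2 * ∑ k ∈ Finset.range N, hypergeometricTerm ((n : K) + 2) k =
      ((n : K) + 1) ^ 2 * ∑ k ∈ Finset.range N, hypergeometricTerm (n : K) k := by
  obtain ⟨M, rfl⟩ : ∃ M, N = M + 1 := ⟨N - 1, by omega⟩
  have hM := sum_hypergeometricTerm_add_two (n : K) M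
  have hz : ∏ j ∈ Finset.range M, ((j : K) - (n + 1)) * (n + 2 + j) = 0 :=
    Finset.prod_eq_zero (i := n + 1) (Finset.mem_range.2 (by omega)) (by push_cast; ring)
  rw [hz, mul_zero] at hM
  exact sub_eq_zero.1 hM

/-- The recurrence for the right-hand side, from the functional equation at `-(n + 2) / 2` and
`(n + 1) / 2` with `n = 2 h`; both points are units because `n + 2 < p`. -/
theorem sq_mul_gammaProduct (hp2 : p ≠ 2) {h : ℕ} (hh : 2 * h + 2 < p) :
    (((2 * h : ℕ) : ℤ_[p]) + 2) ^ 2 * gammaProduct p (((2 * h : ℕ) : ℤ_[p]) + 2) =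
      (((2 * h : ℕ) : ℤ_[p]) + 1) ^ 2 * gammaProduct p ((2 * h : ℕ) : ℤ_[p]) := by
  have hnat : ∀ k : ℕ, 0 < k → k < p → ¬ (p : ℤ_[p]) ∣ (k : ℤ_[p]) := by
    intro k h0 hk
    rw [PadicInt.natCast_dvd_natCast_iff]
    exact Nat.not_dvd_of_pos_of_lt h0 hk
  have e1 : padicHalf (-((2 * h : ℕ) : ℤ_[p])) = -((h + 1 : ℕ) : ℤ_[p]) + 1 := by
    push_cast
    have := two_mul_padicHalf hp2 (1 : ℤ_[p])
    unfold padicHalf at this ⊢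
    linear_combination -(h : ℤ_[p]) * this
  have e2 : padicHalf (-(((2 * h : ℕ) : ℤ_[p]) + 2)) = -((h + 1 : ℕ) : ℤ_[p]) := by
    push_cast
    have := two_mul_padicHalf hp2 (1 : ℤ_[p])
    unfold padicHalf at this ⊢
    linear_combination (-(h : ℤ_[p]) - 1) * this
  have e3 : padicHalf (((2 * h : ℕ) : ℤ_[p]) + 2 + 1) =
      padicHalf (((2 * h : ℕ) : ℤ_[p]) + 1) + 1 := by
    have := two_mul_padicHalf hp2 (1 : ℤ_[p])
    unfold padicHalf at this ⊢
    linear_combination this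
  have e4 := two_mul_padicHalf hp2 (((2 * h : ℕ) : ℤ_[p]) + 1)
  have hd1 : ¬ (p : ℤ_[p]) ∣ -((h + 1 : ℕ) : ℤ_[p]) := by
    rw [dvd_neg]
    exact hnat _ h.succ_pos (by omega)
  have hd2 : ¬ (p : ℤ_[p]) ∣ padicHalf (((2 * h : ℕ) : ℤ_[p]) + 1) := by
    intro hd
    refine hnat (2 * h + 1) (by omega) (by omega) ?_
    rw [Nat.cast_succ, ← e4]
    exact hd.mul_left 2
  unfold gammaProduct
  rw [e1, e2, e3, padicGamma_add_one hp2, padicGamma_add_one hp2, unitFactor_of_not_dvd hd1,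
    unitFactor_of_not_dvd hd2]
  generalize padicHalf (((2 * h : ℕ) : ℤ_[p]) + 1) = y at e4 ⊢
  rw [← e4]
  push_cast
  ring

/-- For even `n < p`, both sides are `((1/2)_{n/2} / (n/2)!)²`: they agree at `n = 0`, and satisfy
the same recurrence. -/
theorem sum_hypergeometricTerm_eq_gammaProduct (hp2 : p ≠ 2) {h : ℕ} (hh : 2 * h < p) :
    ∑ k ∈ Finset.range p, hypergeometricTerm (((2 * h : ℕ) : ℤ_[p]) : ℚ_[p]) k =
      (gammaProduct p ((2 * h : ℕ) : ℤ_[p]) : ℚ_[p]) := by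
  induction h with
  | zero =>
    have hp : p.Prime := Fact.out
    have hg : gammaProduct p ((2 * 0 : ℕ) : ℤ_[p]) = 1 := by
      have h0 : padicHalf (-((2 * 0 : ℕ) : ℤ_[p])) = 0 := by simp [padicHalf]
      rw [gammaProduct, h0, padicGamma_zero hp2, mul_zero, Nat.cast_zero, zero_add,
        padicGamma_half_sq hp2, one_pow, mul_one, ← mul_pow, neg_one_mul, neg_neg, one_pow]
    rw [hg, Finset.sum_eq_single_of_mem 0 (Finset.mem_range.2 hp.pos)]
    · simp [hypergeometricTerm]
    · intro k _ hk
      have h0 : ∏ j ∈ Finset.range k, ((j : ℚ_[p]) - (((2 * 0 : ℕ) : ℤ_[p]) : ℚ_[p])) *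
          ((((2 * 0 : ℕ) : ℤ_[p]) : ℚ_[p]) + 1 + j) = 0 :=
        Finset.prod_eq_zero (i := 0) (Finset.mem_range.2 (Nat.pos_of_ne_zero hk)) (by simp)
      rw [hypergeometricTerm, h0, mul_zero]
  | succ h ih =>
    have ih := ih (by omega)
    have h1 := sq_mul_sum_hypergeometricTerm (K := ℚ_[p]) (n := 2 * h) (N := p) (by omega)
    have h2 := congrArg (fun z : ℤ_[p] => (z : ℚ_[p]))
      (sq_mul_gammaProduct hp2 (p := p) (h := h) (by omega))
    have e : ((2 * (h + 1) : ℕ) : ℤ_[p]) = ((2 * h : ℕ) : ℤ_[p]) + 2 := by push_cast; ring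
    have e' : (((2 * h : ℕ) : ℤ_[p]) + 2 : ℤ_[p]) = (((2 * h : ℕ) : ℚ_[p]) + 2 : ℚ_[p]) := by
      rw [PadicInt.coe_add, PadicInt.coe_natCast]
      rfl
    have hne : (((2 * h : ℕ) : ℚ_[p]) + 2) ^ 2 ≠ 0 :=
      pow_ne_zero _ (by exact_mod_cast (2 * h + 1).succ_ne_zero)
    simp only [PadicInt.coe_mul, PadicInt.coe_pow, PadicInt.coe_add, PadicInt.coe_one,
      PadicInt.coe_natCast] at h2 ih
    rw [e, e']
    refine mul_left_cancel₀ hne ?_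
    rw [h1, ih, ← h2]
    congr 2

end Comparison

theorem theorem2 (p : ℕ) [Fact p.Prime] (hp : 5 ≤ p) (a : ℤ_[p])
    (ha : Even (PadicInt.zmodRepr a)) :
    PadicCongr p 2
      (truncatedHypergeometric [(1 / 2 : ℚ_[p]), -(a : ℚ_[p]), (a : ℚ_[p]) + 1] [1, 1] 1 (p - 1))
      (((-1) ^ ((p + 1) / 2) * padicGamma p (padicHalf (-a)) ^ 2 *
        padicGamma p (padicHalf (a + 1)) ^ 2 : ℤ_[p]) : ℚ_[p]) := by
  have hprime : p.Prime := Fact.out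
  have hp2 : p ≠ 2 := by omega
  obtain ⟨Q, hQ⟩ := exists_polynomial_eval_eq_sum hp2
  obtain ⟨h, hh⟩ := even_iff_two_dvd.1 ha
  obtain ⟨q, hq⟩ := hprime.odd_of_ne_two hp2
  have hlt := PadicInt.zmodRepr_lt_p a
  obtain ⟨t, ht⟩ : (p : ℤ_[p]) ∣ a - (2 * h : ℕ) := by
    have := PadicInt.sub_zmodRepr_mem a
    rwa [hh, PadicInt.maximalIdeal_eq_span_p, Ideal.mem_span_singleton] at this
  have hcongr := (isLinearModSq_polynomial_eval Q ((2 * h : ℕ) : ℤ_[p])).sq_dvd_sub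
    (isLinearModSq_gammaProduct hp2 ((2 * h : ℕ) : ℤ_[p]))
    (by
      rw [mul_zero, add_zero]
      refine PadicInt.ext ?_
      rw [hQ, sum_hypergeometricTerm_eq_gammaProduct hp2 (by omega)])
    (by
      -- `2 h - p` is the mirror image of the even number `p - 1 - 2 h` under `x ↦ -1 - x`
      have hx : ((2 * h : ℕ) : ℤ_[p]) + p * (-1) = -1 - ((2 * (q - h) : ℕ) : ℤ_[p]) := by
        have : 2 * h + 1 + 2 * (q - h) = p := by omega
        have := congrArg (Nat.cast (R := ℤ_[p])) this
        push_cast at this ⊢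
        linear_combination this
      rw [hx, gammaProduct_symm]
      refine PadicInt.ext ?_
      rw [hQ, ← sum_hypergeometricTerm_eq_gammaProduct hp2 (by omega)]
      refine Finset.sum_congr rfl fun k _ => ?_
      rw [PadicInt.coe_sub, PadicInt.coe_neg, PadicInt.coe_one, hypergeometricTerm_symm]) t
  rw [← ht, add_sub_cancel] at hcongr
  obtain ⟨c, hc⟩ := hcongr
  refine ⟨c, ?_⟩
  rw [truncatedHypergeometric_eq_sum, Nat.sub_add_cancel hprime.one_le, ← hQ]
  change ((Q.eval a : ℤ_[p]) : ℚ_[p]) - (gammaProduct p a : ℚ_[p]) = _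
  rw [← PadicInt.coe_sub, hc]
  push_cast
  rfl
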